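/- Let $\mathcal X,\mathcal Y$ be finite alphabets and let $(\mathbf X,\mathbf Y)=\{(X^n,Y^n)\}_{n\ge1}$ be a general correlated source, i.e. for every $n$ an arbitrary joint distribution $P_{X^nY^n}$ on $\mathcal X^n\times\mathcal Y^n$. Logarithms are to base $2$. The source is called smooth if there is a constant $0<q<1$, independent of $n$, such that $P_{X^nY^n}(x,\hat y)\ge q\,P_{X^nY^n}(x,y)$ for all $n$, $x\in\mathcal X^n$ and $y,\hat y\in\mathcal Y^n$ at Hamming distance $1$, and likewise (with some such constant) with the roles of $x$ and $y$ exchanged. Let $\mathbf f=\{f_n\}_{n\ge1}$ with $f_n:\mathcal X^n\times\mathcal Y^n\to\mathcal Z_n$. The function $f_n$ is sensitive conditioned on $\mathcal Y^n$ if, whenever $f_n(x,y)=f_n(\hat x,y)$ and $x_i\ne\hat x_i$, there is $\hat y\in\mathcal Y^n$ that differs from $y$ exactly in position $i$ and satisfies $f_n(x,\hat y)\ne f_n(\hat x,\hat y)$; sensitivity conditioned on $\mathcal X^n$ is defined by exchanging the roles of $x$ and $y$. For $z\in\mathcal Z_n$ let $\mathrm{EQ}(z|f_n)$ be the largest $J$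 for which there are $J$ pairs $(x_1,y_1),\dots,(x_J,y_J)\in\mathcal X^n\times\mathcal Y^n$ with $x_i\ne x_j$ and $y_i\ne y_j$ for all $i\ne j$ and $f_n(x_i,y_i)=z$ for all $i$. For $r\ge0$, $\mathbf f$ is $r$-totally sensitive if every $f_n$ is sensitive conditioned on $\mathcal X^n$ and conditioned on $\mathcal Y^n$, and $\limsup_{n\to\infty}\frac1n\log\max_{z\in\mathcal Z_n}\mathrm{EQ}(z|f_n)\le r$. A variable-length code for $f_n$ consists of encoders $\varphi^{(1)}_n:\mathcal X^n\to\{0,1\}^*$ and $\varphi^{(2)}_n:\mathcal Y^n\to\{0,1\}^*$, each of whose sets of codewords satisfies the prefix condition (no codeword is a proper prefix of another), and a decoder $\psi_n$ that maps pairs of codewords to $\mathcal Z_n$; it is a fixed-length code if, for each encoder, all its codewords have the same length. A pair $(R_1,R_2)\in\mathbb R^2$ is achievable for $\mathbf f$ by variable-length (resp. fixed-length) coding if there is a sequence of variable-length (resp. fixed-length) codes with $$\lim_{n\to\infty}\Pr\{f_n(X^n,Y^n)\ne\psi_n(\varphi^{(1)}_n(X^n),\varphi^{(2)}_n(Y^n))\}=0,$$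 $$\limsup_{n\to\infty}\tfrac1n\mathbb E|\varphi_n^{(1)}(X^n)|\le R_1,\qquad \limsup_{n\to\infty}\tfrac1n\mathbb E|\varphi_n^{(2)}(Y^n)|\le R_2.$$ Let $\mathcal R^{**}(\mathbf X,\mathbf Y|\mathbf f)$ be the set of achievable pairs, where $**$ is $\mathrm{fl}$ (fixed-length) or $\mathrm{vl}$ (variable-length). The Slepian-Wolf (SW) region $\mathcal R^{**}_{\mathrm{SW}}(\mathbf X,\mathbf Y)$ is the set of pairs achievable for the identity functions $(x,y)\mapsto(x,y)$, and $$R^{**}_{\mathrm{SW}}(\mathbf X|\mathbf Y)=\inf\{R_1:(R_1,\log|\mathcal Y|)\in\mathcal R^{**}_{\mathrm{SW}}(\mathbf X,\mathbf Y)\},\qquad R^{**}_{\mathrm{SW}}(\mathbf Y|\mathbf X)=\inf\{R_2:(\log|\mathcal X|,R_2)\in\mathcal R^{**}_{\mathrm{SW}}(\mathbf X,\mathbf Y)\}.$$ Theorem. Let $r\ge0$, let $(\mathbf X,\mathbf Y)$ be smooth and let $\mathbf f$ be $r$-totally sensitive. Then, both for $**=\mathrm{fl}$ and for $**=\mathrm{vl}$,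 every $(R_1,R_2)\in\mathcal R^{**}(\mathbf X,\mathbf Y|\mathbf f)$ satisfies $R_1\ge R^{**}_{\mathrm{SW}}(\mathbf X|\mathbf Y)$ and $R_2\ge R^{**}_{\mathrm{SW}}(\mathbf Y|\mathbf X)$, and there is $\lambda\in[0,1]$ with $(R_1+\lambda r,\,R_2+(1-\lambda)r)\in\mathcal R^{**}_{\mathrm{SW}}(\mathbf X,\mathbf Y)$. -/

import Mathlib

open Filter

namespace DistComp

section Source

/-- A general correlated source with alphabets `X`, `Y`: for every block length `n` an arbitrary
joint distribution of `(Xⁿ, Yⁿ)` (no stationarity, ergodicity or consistency is required).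
The value at `n = 0` carries no information. -/
abbrev Source (X Y : Type*) := (n : ℕ) → PMF ((Fin n → X) × (Fin n → Y))

variable {X Y : Type*}

/-- The joint probability of `(x, y)` under `(Xⁿ, Yⁿ)`, as a real number. -/
noncomputable def Source.prob (P : Source X Y) {n : ℕ} (x : Fin n → X) (y : Fin n → Y) : ℝ :=
  (P n (x, y)).toReal

/-- Smoothness with respect to `Y`: changing one symbol of `y` decreases the joint probability
at most by a constant factor `q` that does not depend on `n`. -/
def Source.SmoothRight [DecidableEq Y] (P : Source X Y) : Prop :=
  ∃ q : ℝ, 0 < q ∧ q < 1 ∧ ∀ (n : ℕ) (x : Fin n → X) (y y' : Fin n → Y),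
    hammingDist y y' = 1 → q * P.prob x y ≤ P.prob x y'

/-- Smoothness with respect to `X`. -/
def Source.SmoothLeft [DecidableEq X] (P : Source X Y) : Prop :=
  ∃ q : ℝ, 0 < q ∧ q < 1 ∧ ∀ (n : ℕ) (x x' : Fin n → X) (y : Fin n → Y),
    hammingDist x x' = 1 → q * P.prob x y ≤ P.prob x' y

/-- A smooth source is smooth with respect to both components. -/
def Source.Smooth [DecidableEq X] [DecidableEq Y] (P : Source X Y) : Prop :=
  P.SmoothLeft ∧ P.SmoothRight

end Source

section Functions

variable {X Y : Type*}

/-- `f` is sensitive conditioned on `𝒴ⁿ`. -/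
def SensitiveGivenRight {n : ℕ} {Z : Type*} (f : (Fin n → X) → (Fin n → Y) → Z) : Prop :=
  ∀ (x x' : Fin n → X) (y : Fin n → Y) (i : Fin n), f x y = f x' y → x i ≠ x' i →
    ∃ y' : Fin n → Y, y' i ≠ y i ∧ (∀ j, j ≠ i → y' j = y j) ∧ f x y' ≠ f x' y'

/-- `f` is sensitive conditioned on `𝒳ⁿ`. -/
def SensitiveGivenLeft {n : ℕ} {Z : Type*} (f : (Fin n → X) → (Fin n → Y) → Z) : Prop :=
  ∀ (y y' : Fin n → Y) (x : Fin n → X) (i : Fin n), f x y = f x y' → y i ≠ y' i →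
    ∃ x' : Fin n → X, x' i ≠ x i ∧ (∀ j, j ≠ i → x' j = x j) ∧ f x' y ≠ f x' y'

/-- The set of all `J` for which there are `J` pairs in the preimage of `z` whose first components
are pairwise distinct and whose second components are pairwise distinct. -/
def diagonalSizes {n : ℕ} {Z : Type*} (f : (Fin n → X) → (Fin n → Y) → Z) (z : Z) : Set ℕ :=
  {J | ∃ (x : Fin J → Fin n → X) (y : Fin J → Fin n → Y),
    Function.Injective x ∧ Function.Injective y ∧ ∀ i, f (x i) (y i) = z}

/-- `EQ f z` is the largest size of a diagonal family in the preimage of `z`. -/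
noncomputable def EQ {n : ℕ} {Z : Type*} (f : (Fin n → X) → (Fin n → Y) → Z) (z : Z) : ℕ :=
  sSup (diagonalSizes f z)

/-- For finite alphabets the supremum defining `EQ` is over a nonempty bounded set, so it is a
maximum. -/
theorem EQ_mem [Fintype X] {n : ℕ} {Z : Type*}
    (f : (Fin n → X) → (Fin n → Y) → Z) (z : Z) :
    BddAbove (diagonalSizes f z) ∧ EQ f z ∈ diagonalSizes f z := by
  classical
  have hb : BddAbove (diagonalSizes f z) := by
    refine ⟨Fintype.card (Fin n → X), ?_⟩
    rintro J ⟨x, y, hx, -, -⟩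
    simpa using Fintype.card_le_of_injective x hx
  refine ⟨hb, Nat.sSup_mem ⟨0, ?_⟩ hb⟩
  exact ⟨fun i => i.elim0, fun i => i.elim0, fun i => i.elim0, fun i => i.elim0,
    fun i => i.elim0⟩

/-- `max_z EQ(z | f)`. -/
noncomputable def maxEQ {n : ℕ} {Z : Type*} (f : (Fin n → X) → (Fin n → Y) → Z) : ℕ :=
  ⨆ z, EQ f z

/-- The supremum in `maxEQ` is over a bounded set of natural numbers. -/
theorem bddAbove_range_EQ [Fintype X] {n : ℕ} {Z : Type*}
    (f : (Fin n → X) → (Fin n → Y) → Z) : BddAbove (Set.range (EQ f)) := by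
  classical
  refine ⟨Fintype.card (Fin n → X), ?_⟩
  rintro _ ⟨z, rfl⟩
  obtain ⟨x, y, hx, -, -⟩ := (EQ_mem f z).2
  simpa using Fintype.card_le_of_injective x hx

/-- The sequence `f = (f_n)` is `r`-totally sensitive. The upper limit is taken in `EReal`. -/
def RTotallySensitive {Z : ℕ → Type*} (r : ℝ)
    (f : (n : ℕ) → (Fin n → X) → (Fin n → Y) → Z n) : Prop :=
  limsup (fun n : ℕ => ((1 / (n : ℝ) * Real.logb 2 (maxEQ (f n) : ℝ) : ℝ) : EReal)) atTop
      ≤ (r : EReal) ∧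
  (∀ n, SensitiveGivenLeft (f n)) ∧ (∀ n, SensitiveGivenRight (f n))

end Functions

section Codes

/-- The image of an encoder satisfies the prefix condition: no codeword is a prefix of a different
codeword. (The encoder itself need not be injective.) -/
def PrefixFree {A : Type*} (φ : A → List Bool) : Prop :=
  ∀ a b, φ a <+: φ b → φ a = φ b

/-- A variable-length code with block length `n` and reproduction alphabet `Z`. The decoder is
written as a function of arbitrary binary strings; only its values on pairs of codewords matter. -/
structure Code (X Y : Type*) (n : ℕ) (Z : Type*) where
  enc₁ : (Fin n → X) → List Bool
  enc₂ : (Fin n → Y) → List Bool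
  dec : List Bool → List Bool → Z
  prefixFree₁ : PrefixFree enc₁
  prefixFree₂ : PrefixFree enc₂

/-- All codewords of the same encoder have the same length, for both encoders. -/
def Code.FixedLength {X Y : Type*} {n : ℕ} {Z : Type*} (c : Code X Y n Z) : Prop :=
  (∀ x x', (c.enc₁ x).length = (c.enc₁ x').length) ∧
  (∀ y y', (c.enc₂ y).length = (c.enc₂ y').length)

/-- The two kinds of coding. -/
inductive Mode
  | fixedLength
  | variableLength

/-- The codes allowed in a given mode. -/
def Code.Allowed {X Y : Type*} {n : ℕ} {Z : Type*} (m : Mode) (c : Code X Y n Z) : Prop :=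
  match m with
  | Mode.fixedLength => c.FixedLength
  | Mode.variableLength => True

variable {X Y : Type*} [Fintype X] [Fintype Y]

/-- Average codeword length of the first encoder, `∑ₓ P_{Xⁿ}(x) |φ⁽¹⁾(x)|`. -/
noncomputable def Code.avgLength₁ (P : Source X Y) {n : ℕ} {Z : Type*} (c : Code X Y n Z) : ℝ :=
  ∑ x : Fin n → X, (∑ y : Fin n → Y, P.prob x y) * ((c.enc₁ x).length : ℝ)

/-- Average codeword length of the second encoder, `∑_y P_{Yⁿ}(y) |φ⁽²⁾(y)|`. -/
noncomputable def Code.avgLength₂ (P : Source X Y) {n : ℕ} {Z : Type*} (c : Code X Y n Z) : ℝ :=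
  ∑ y : Fin n → Y, (∑ x : Fin n → X, P.prob x y) * ((c.enc₂ y).length : ℝ)

open Classical in
/-- Probability that the decoder does not output `f(Xⁿ, Yⁿ)`. -/
noncomputable def Code.errorProb (P : Source X Y) {n : ℕ} {Z : Type*} (c : Code X Y n Z)
    (f : (Fin n → X) → (Fin n → Y) → Z) : ℝ :=
  ∑ x : Fin n → X, ∑ y : Fin n → Y,
    if f x y ≠ c.dec (c.enc₁ x) (c.enc₂ y) then P.prob x y else 0

/-- The set of rate pairs achievable for computing `f` in mode `m`. The upper limits are taken in
`EReal`, so that unbounded average lengths have upper limit `⊤`. -/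
def rateRegion (m : Mode) (P : Source X Y) {Z : ℕ → Type*}
    (f : (n : ℕ) → (Fin n → X) → (Fin n → Y) → Z n) : Set (ℝ × ℝ) :=
  {R | ∃ c : (n : ℕ) → Code X Y n (Z n), (∀ n, (c n).Allowed m) ∧
    Tendsto (fun n => (c n).errorProb P (f n)) atTop (nhds 0) ∧
    limsup (fun n : ℕ => ((1 / (n : ℝ) * (c n).avgLength₁ P : ℝ) : EReal)) atTop
      ≤ (R.1 : EReal) ∧
    limsup (fun n : ℕ => ((1 / (n : ℝ) * (c n).avgLength₂ P : ℝ) : EReal)) atTop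
      ≤ (R.2 : EReal)}

/-- The Slepian-Wolf region: the achievable region for the identity functions. -/
def swRegion (m : Mode) (P : Source X Y) : Set (ℝ × ℝ) :=
  rateRegion m P (fun _ x y => (x, y))

/-- The Slepian-Wolf rate of `X` given full side-information `Y`. -/
noncomputable def swRateLeft (m : Mode) (P : Source X Y) : ℝ :=
  sInf {R₁ : ℝ | (R₁, Real.logb 2 (Fintype.card Y)) ∈ swRegion m P}

/-- The Slepian-Wolf rate of `Y` given full side-information `X`. -/
noncomputable def swRateRight (m : Mode) (P : Source X Y) : ℝ :=
  sInf {R₂ : ℝ | (Real.logb 2 (Fintype.card X), R₂) ∈ swRegion m P}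

end Codes

end DistComp

namespace DistComp

/-! A code for `f` with vanishing error can be upgraded to a code for the identity by appending a
few hash bits to its codewords. Let `g` be the function the code computes. If `x` and `x'` share a
codeword, `g` cannot tell them apart. So by sensitivity, wherever they differ, changing that letter
of `y`, or leaving it alone, makes `g` wrong at `x` or at `x'` (`hammingDist_le_badPositions`).
Smoothness bounds the expected number of such bad positions by `n` times a constant times the error
probability (`sum_badPositions_le`). By Markov, outside an event of vanishing probability, the words
`x` compatible with a given `y` and a given codeword are within distance `o(n)` of each other, hence
subexponentially many (`exists_robustSet_seq`). If `y` is known, `o(n)` hash bits then identify `x`,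
and symmetrically; this gives the two single-rate bounds. If only the two codewords are known, the
compatible pairs form a bipartite graph on which `f` is constant. Its matchings have at most `maxEQ
f` edges and its degrees are subexponential, so a maximal matching shows that few `x` occur
(`ncard_image_fst_le`). About `n * r + o(n)` hash bits recover `x`, and `o(n)` more recover `y`. The
whole surcharge `r` falls on the first encoder, so `λ = 1` always works. -/

/-! ### Random hashing -/

/-- Exchanging the value at `i` with the extra letter is an involution on pairs `(h, b)`; after
reindexing by it the extra letter is free and contributes the factor. -/
theorem sum_sum_update {ι β : Type*} [Fintype ι] [DecidableEq ι] [Fintype β] (i : ι)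
    (F : (ι → β) → ℝ) :
    ∑ h : ι → β, ∑ b, F (Function.update h i b) = Fintype.card β * ∑ h, F h := by
  have hinv : Function.Involutive
      (fun t : (ι → β) × β => (Function.update t.1 i t.2, t.1 i)) := by
    rintro ⟨h, b⟩
    simp
  calc ∑ h : ι → β, ∑ b, F (Function.update h i b)
      = ∑ t : (ι → β) × β, F (Function.update t.1 i t.2) := by
        rw [Fintype.sum_prod_type]
    _ = ∑ t : (ι → β) × β, F t.1 :=
        Fintype.sum_equiv hinv.toPerm _ _ fun _ => rfl
    _ = Fintype.card β * ∑ h, F h := by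
        rw [Fintype.sum_prod_type]
        simp [Finset.mul_sum]

/-- A uniformly random function separates two distinct points except with probability
`1 / |B|`. -/
theorem sum_collision {A B : Type*} [Fintype A] [DecidableEq A] [Fintype B] [DecidableEq B]
    {a a' : A} (h : a' ≠ a) :
    (Fintype.card B : ℝ) * ∑ g : A → B, (if g a' = g a then (1 : ℝ) else 0)
      = Fintype.card (A → B) := by
  -- Resample `g` at `a'` only: `g a` stays fixed, and exactly one of the new values collides with
  -- it.
  rw [← sum_sum_update a']
  simp [Function.update_of_ne h.symm]

/-- Random binning: some hash function isolates the true value inside a list of size at most `M`,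
except with probability `M / |B|`. -/
theorem exists_hash {Ω A : Type*} (B : Type*) [Fintype Ω] [Fintype A] [Fintype B] [Nonempty B]
    (p : Ω → ℝ) (hp : ∀ ω, 0 ≤ p ω) (a : Ω → A) (S : Ω → Set A) (M : ℝ)
    (hM : ∀ ω, ((S ω).ncard : ℝ) ≤ M) :
    ∃ h : A → B, ∑ ω, {ω | ∃ a' ∈ S ω, a' ≠ a ω ∧ h a' = h (a ω)}.indicator p ω
      ≤ (∑ ω, p ω) * (M / Fintype.card B) := by
  classical
  have hB : (0 : ℝ) < Fintype.card B := by exact_mod_cast Fintype.card_pos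
  have hH : (0 : ℝ) < Fintype.card (A → B) := by exact_mod_cast Fintype.card_pos
  -- First moment method: some `h` does no worse than the average over all functions, which a union
  -- bound over the list estimates.
  obtain ⟨h, -, hh⟩ := Finset.exists_le_of_sum_le (s := (Finset.univ : Finset (A → B)))
    (f := fun h => ∑ ω, {ω | ∃ a' ∈ S ω, a' ≠ a ω ∧ h a' = h (a ω)}.indicator p ω)
    (g := fun _ => (∑ ω, p ω) * (M / Fintype.card B)) Finset.univ_nonempty (by
      rw [Finset.sum_comm, Finset.sum_const, Finset.card_univ, nsmul_eq_mul, Finset.sum_mul,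
        Finset.mul_sum]
      refine Finset.sum_le_sum fun ω _ => ?_
      calc ∑ h : A → B, {ω | ∃ a' ∈ S ω, a' ≠ a ω ∧ h a' = h (a ω)}.indicator p ω
          ≤ ∑ h : A → B, ∑ a' ∈ (S ω).toFinset.erase (a ω),
              p ω * (if h a' = h (a ω) then (1 : ℝ) else 0) := by
            refine Finset.sum_le_sum fun h _ => ?_
            have hnn : ∀ a' ∈ (S ω).toFinset.erase (a ω),
                0 ≤ p ω * (if h a' = h (a ω) then (1 : ℝ) else 0) := fun a' _ =>
              mul_nonneg (hp ω) (by split_ifs <;> norm_num)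
            by_cases hω : ω ∈ {ω | ∃ a' ∈ S ω, a' ≠ a ω ∧ h a' = h (a ω)}
            · rw [Set.indicator_of_mem hω]
              obtain ⟨a', h1, h2, h3⟩ := hω
              refine le_trans ?_ (Finset.single_le_sum hnn (a := a') (by simp [h1, h2]))
              simp [h3]
            · rw [Set.indicator_of_notMem hω]
              exact Finset.sum_nonneg hnn
        _ = ∑ a' ∈ (S ω).toFinset.erase (a ω),
              p ω * (Fintype.card (A → B) / Fintype.card B) := by
            rw [Finset.sum_comm]
            refine Finset.sum_congr rfl fun a' ha' => ?_
            rw [← Finset.mul_sum, ← sum_collision (Finset.ne_of_mem_erase ha'),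
              mul_div_cancel_left₀ _ hB.ne']
        _ = ((S ω).toFinset.erase (a ω)).card
              * (p ω * (Fintype.card (A → B) / Fintype.card B)) := by
            rw [Finset.sum_const, nsmul_eq_mul]
        _ ≤ M * (p ω * (Fintype.card (A → B) / Fintype.card B)) := by
            refine mul_le_mul_of_nonneg_right (le_trans ?_ (hM ω))
              (mul_nonneg (hp ω) (by positivity))
            rw [Set.ncard_eq_toFinset_card']
            exact_mod_cast Finset.card_erase_le
        _ = _ := by ring)
  exact ⟨h, hh⟩

/-! ### Hamming balls -/

/-- The weight `s ^ d` is a product over coordinates, so the sum factors; each factor is at most `1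
+ |X| * s`. -/
theorem sum_pow_hammingDist {X : Type*} [Fintype X] [DecidableEq X] {n : ℕ} (x : Fin n → X)
    (s : ℝ) (hs : 0 ≤ s) :
    ∑ x' : Fin n → X, s ^ hammingDist x x' ≤ (1 + Fintype.card X * s) ^ n := by
  have h1 : ∀ x' : Fin n → X, s ^ hammingDist x x' = ∏ i, if x i ≠ x' i then s else 1 := by
    intro x'
    rw [Finset.prod_ite]
    simp [hammingDist]
  simp_rw [h1]
  rw [← Fintype.piFinset_univ,
    ← Finset.prod_univ_sum (fun _ => Finset.univ) (fun i a => if x i ≠ a then s else 1)]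
  calc _ ≤ ∏ _i : Fin n, (1 + Fintype.card X * s) := by
        refine Finset.prod_le_prod (fun i _ => Finset.sum_nonneg fun a _ => ?_) fun i _ => ?_
        · split_ifs <;> linarith
        · calc ∑ a, (if x i ≠ a then s else 1) ≤ ∑ a, ((if x i = a then 1 else 0) + s) := by
                refine Finset.sum_le_sum fun a _ => ?_
                by_cases h : x i = a <;> simp [h, hs]
            _ = _ := by simp [Finset.sum_add_distrib]
    _ = _ := by simp

/-- An upper bound for the size of Hamming balls of radius `2 * β * n` in a space of words of
length `n` over an alphabet with at most `A` letters. -/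
noncomputable def ballBound (A β : ℝ) (n : ℕ) : ℝ := β ^ (-(2 * β * n)) * (1 + A * β) ^ n

theorem one_le_ballBound {A β : ℝ} (hA : 0 ≤ A) (hβ : 0 < β) (hβ1 : β ≤ 1) (n : ℕ) :
    1 ≤ ballBound A β n := by
  refine one_le_mul_of_one_le_of_one_le ?_ (one_le_pow₀ (by nlinarith))
  exact Real.one_le_rpow_of_pos_of_le_one_of_nonpos hβ hβ1 (by
    have : 0 ≤ 2 * β * n := by positivity
    linarith)

/-- Chernoff-style count around one word of `S`: every word of `S` has weight at least `β ^ (2βn)`,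
while the total weight is at most `(1 + Aβ) ^ n`. Allowing `A` to exceed the alphabet size lets one
bound serve both alphabets. -/
theorem ncard_le_ballBound {X : Type*} [Fintype X] [DecidableEq X] {n : ℕ} {A β : ℝ}
    (hA : Fintype.card X ≤ A) (hβ : 0 < β) (hβ1 : β ≤ 1) (S : Set (Fin n → X))
    (hS : ∀ x ∈ S, ∀ x' ∈ S, (hammingDist x x' : ℝ) ≤ 2 * β * n) :
    (S.ncard : ℝ) ≤ ballBound A β n := by
  classical
  have hA0 : 0 ≤ A := le_trans (Nat.cast_nonneg _) hA
  rcases S.eq_empty_or_nonempty with rfl | ⟨x, hx⟩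
  · simpa using (zero_le_one.trans (one_le_ballBound hA0 hβ hβ1 n))
  have hpos : 0 < β ^ (2 * β * n) := Real.rpow_pos_of_pos hβ _
  have key : (S.ncard : ℝ) * β ^ (2 * β * n) ≤ (1 + A * β) ^ n :=
    calc (S.ncard : ℝ) * β ^ (2 * β * n) = ∑ x' ∈ S.toFinset, β ^ (2 * β * n) := by
          rw [Finset.sum_const, nsmul_eq_mul, Set.ncard_eq_toFinset_card']
      _ ≤ ∑ x' ∈ S.toFinset, β ^ hammingDist x x' := by
          refine Finset.sum_le_sum fun x' hx' => ?_
          rw [← Real.rpow_natCast]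
          exact Real.rpow_le_rpow_of_exponent_ge hβ hβ1 (hS x hx x' (by simpa using hx'))
      _ ≤ ∑ x', β ^ hammingDist x x' :=
          Finset.sum_le_univ_sum_of_nonneg fun x' => by positivity
      _ ≤ (1 + Fintype.card X * β) ^ n := sum_pow_hammingDist x β hβ.le
      _ ≤ (1 + A * β) ^ n := by gcongr
  rw [ballBound, Real.rpow_neg hβ.le, inv_mul_eq_div, le_div_iff₀ hpos]
  exact key

/-! ### Matchings in bipartite graphs -/

/-- If the edges `E` of a bipartite graph contain no matching with more than `J` edges and every
right vertex has degree at most `L`, then at most `J + J * L` left vertices are non-isolated. -/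
theorem ncard_image_fst_le {α β : Type*} [Finite α] [Finite β] (E : Set (α × β)) (J : ℕ) (L : ℝ) (hL0 : 0 ≤ L)
    (hL : ∀ y, (({x | (x, y) ∈ E} : Set α).ncard : ℝ) ≤ L)
    (hJ : ∀ M ⊆ E, Set.InjOn Prod.fst M → Set.InjOn Prod.snd M → M.ncard ≤ J) :
    ((Prod.fst '' E).ncard : ℝ) ≤ J + J * L := by
  classical
  cases nonempty_fintype α
  cases nonempty_fintype β
  obtain ⟨M, ⟨hM, h1, h2⟩, hmax⟩ := (Set.toFinite
    {M : Set (α × β) | M ⊆ E ∧ Set.InjOn Prod.fst M ∧ Set.InjOn Prod.snd M}).exists_maximal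
    ⟨∅, by simp⟩
  -- A left vertex is matched or has a matched neighbour; otherwise one of its edges could be added
  -- to the maximal matching.
  have hcov : Prod.fst '' E ⊆
      ↑(M.toFinset.image Prod.fst ∪
        M.toFinset.biUnion fun m => ({x | (x, m.2) ∈ E} : Set α).toFinset) := by
    rintro _ ⟨⟨x, y⟩, hxy, rfl⟩
    by_contra hcon
    simp only [Finset.coe_union, Finset.coe_image, Set.coe_toFinset, Finset.coe_biUnion,
      Set.mem_union, Set.mem_image, Set.mem_iUnion, not_or, not_exists, not_and,
      Set.mem_ofPred_eq, exists_prop] at hcon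
    obtain ⟨hc1, hc2⟩ := hcon
    have hc2' : ∀ m ∈ M, m.2 ≠ y := fun m hm h => hc2 m hm (h ▸ hxy)
    have hsub : insert (x, y) M ⊆ M := hmax ⟨Set.insert_subset hxy hM,
      (Set.injOn_insert fun h => hc1 _ h rfl).2 ⟨h1, by rintro ⟨m, hm, h⟩; exact hc1 m hm h⟩,
      (Set.injOn_insert fun h => hc1 _ h rfl).2 ⟨h2, by rintro ⟨m, hm, h⟩; exact hc2' m hm h⟩⟩
      (Set.subset_insert _ _)
    exact hc1 _ (hsub (Set.mem_insert _ _)) rfl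
  have hMJ : M.toFinset.card ≤ J := by
    rw [← Set.ncard_eq_toFinset_card']
    exact hJ M hM h1 h2
  have hMJ' : (M.toFinset.card : ℝ) ≤ J := by exact_mod_cast hMJ
  have hc := Set.ncard_le_ncard hcov (Finset.finite_toSet _)
  rw [Set.ncard_coe_finset] at hc
  calc ((Prod.fst '' E).ncard : ℝ)
      ≤ ((M.toFinset.image Prod.fst ∪
        M.toFinset.biUnion fun m => ({x | (x, m.2) ∈ E} : Set α).toFinset).card : ℝ) := by
        exact_mod_cast hc
    _ ≤ (M.toFinset.image Prod.fst).card
        + (M.toFinset.biUnion fun m => ({x | (x, m.2) ∈ E} : Set α).toFinset).card := by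
        exact_mod_cast Finset.card_union_le _ _
    _ ≤ M.toFinset.card + ∑ m ∈ M.toFinset, (({x | (x, m.2) ∈ E} : Set α).toFinset.card : ℝ) := by
        refine add_le_add (by exact_mod_cast Finset.card_image_le) ?_
        exact_mod_cast Finset.card_biUnion_le
    _ ≤ M.toFinset.card + ∑ m ∈ M.toFinset, L := by
        gcongr with m
        rw [← Set.ncard_eq_toFinset_card']
        exact hL m.2
    _ = M.toFinset.card + M.toFinset.card * L := by rw [Finset.sum_const, nsmul_eq_mul]
    _ ≤ J + J * L := by gcongr

/-! ### Weights and Markov's inequality -/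

/-- The total weight of a set. -/
noncomputable def mass {Ω : Type*} [Fintype Ω] (p : Ω → ℝ) (E : Set Ω) : ℝ :=
  ∑ ω, E.indicator p ω

section Mass

variable {Ω : Type*} [Fintype Ω] {p : Ω → ℝ}

theorem mass_mono (hp : ∀ ω, 0 ≤ p ω) {E F : Set Ω} (h : E ⊆ F) : mass p E ≤ mass p F :=
  Finset.sum_le_sum fun ω _ => Set.indicator_le_indicator_of_subset h hp ω

theorem mass_nonneg (hp : ∀ ω, 0 ≤ p ω) (E : Set Ω) : 0 ≤ mass p E :=
  Finset.sum_nonneg fun ω _ => Set.indicator_nonneg (fun ω _ => hp ω) ω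

theorem mass_union_le (hp : ∀ ω, 0 ≤ p ω) (E F : Set Ω) :
    mass p (E ∪ F) ≤ mass p E + mass p F := by
  classical
  rw [mass, mass, mass, ← Finset.sum_add_distrib]
  refine Finset.sum_le_sum fun ω _ => ?_
  have := hp ω
  by_cases hE : ω ∈ E <;> by_cases hF : ω ∈ F <;> simp [hE, hF, this]

/-- Markov's inequality. -/
theorem mul_mass_lt_le (hp : ∀ ω, 0 ≤ p ω) (N : Ω → ℝ) (hN : ∀ ω, 0 ≤ N ω) (t : ℝ) :
    t * mass p {ω | t < N ω} ≤ ∑ ω, p ω * N ω := by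
  classical
  rw [mass, Finset.mul_sum]
  refine Finset.sum_le_sum fun ω _ => ?_
  by_cases h : t < N ω
  · rw [Set.indicator_of_mem (by exact h), mul_comm]
    exact mul_le_mul_of_nonneg_left h.le (hp ω)
  · rw [Set.indicator_of_notMem (by exact h), mul_zero]
    exact mul_nonneg (hp ω) (hN ω)

end Mass

/-! ### Bad positions: smoothness and sensitivity -/

/-- The positions at which `y` can be modified to a word in `W`. -/
def badPositions {Y : Type*} {n : ℕ} (W : Set (Fin n → Y)) (y : Fin n → Y) : Set (Fin n) :=
  {i | ∃ b, Function.update y i b ∈ W}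

/-- Each bad position is charged to a modified word in `W`, whose weight is at least `q` times that
of `y`. For a fixed position, summing over all modifications counts each word `|Y|` times. -/
theorem sum_badPositions_le {A Y : Type*} [Fintype A] [Fintype Y] [DecidableEq Y] {n : ℕ}
    (p : A → (Fin n → Y) → ℝ) (hp : ∀ x y, 0 ≤ p x y) {q : ℝ} (hq : 0 < q) (hq1 : q < 1)
    (hsm : ∀ x y y', hammingDist y y' = 1 → q * p x y ≤ p x y') (W : A → Set (Fin n → Y)) :
    ∑ x, ∑ y, p x y * (badPositions (W x) y).ncard
      ≤ n * (Fintype.card Y / q) * ∑ x, ∑ y, (W x).indicator (p x) y := by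
  classical
  have hupd : ∀ x y i b, p x y ≤ q⁻¹ * p x (Function.update y i b) := by
    intro x y i b
    rw [le_inv_mul_iff₀ hq]
    -- Smoothness says nothing about the trivial modification; there `q < 1` suffices.
    by_cases h : y i = b
    · subst h
      rw [Function.update_eq_self]
      nlinarith [hp x y]
    · refine hsm x y _ ?_
      rw [hammingDist, Finset.card_eq_one]
      refine ⟨i, ?_⟩
      ext j
      by_cases hj : j = i
      · subst hj; simp [h]
      · simp [hj]
  rw [Finset.mul_sum]
  refine Finset.sum_le_sum fun x _ => ?_
  have hpt : ∀ y, p x y * (badPositions (W x) y).ncard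
      ≤ ∑ i, ∑ b, q⁻¹ * (W x).indicator (p x) (Function.update y i b) := by
    intro y
    have hnn : ∀ i b, 0 ≤ q⁻¹ * (W x).indicator (p x) (Function.update y i b) := fun i b =>
      mul_nonneg (inv_nonneg.2 hq.le) (Set.indicator_nonneg (fun y _ => hp x y) _)
    rw [Set.ncard_eq_toFinset_card', mul_comm, ← nsmul_eq_mul, ← Finset.sum_const]
    calc ∑ _i ∈ (badPositions (W x) y).toFinset, p x y
        ≤ ∑ i ∈ (badPositions (W x) y).toFinset,
            ∑ b, q⁻¹ * (W x).indicator (p x) (Function.update y i b) := by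
          refine Finset.sum_le_sum fun i hi => ?_
          obtain ⟨b, hb⟩ : i ∈ badPositions (W x) y := by simpa using hi
          refine le_trans ?_ (Finset.single_le_sum (fun b _ => hnn i b) (Finset.mem_univ b))
          rw [Set.indicator_of_mem hb]
          exact hupd x y i b
      _ ≤ _ := Finset.sum_le_univ_sum_of_nonneg fun i => Finset.sum_nonneg fun b _ => hnn i b
  calc ∑ y, p x y * (badPositions (W x) y).ncard
      ≤ ∑ y, ∑ i, ∑ b, q⁻¹ * (W x).indicator (p x) (Function.update y i b) :=
        Finset.sum_le_sum fun y _ => hpt y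
    _ = ∑ i : Fin n, q⁻¹ * (Fintype.card Y * ∑ y, (W x).indicator (p x) y) := by
        rw [Finset.sum_comm]
        refine Finset.sum_congr rfl fun i _ => ?_
        rw [← sum_sum_update i, Finset.mul_sum]
        simp_rw [Finset.mul_sum]
    _ = _ := by
        rw [Finset.sum_const, Finset.card_univ, Fintype.card_fin, nsmul_eq_mul]
        ring

theorem mass_many_badPositions_le {A Y : Type*} [Fintype A] [Fintype Y] [DecidableEq Y] {n : ℕ}
    (p : A → (Fin n → Y) → ℝ) (hp : ∀ x y, 0 ≤ p x y) {q : ℝ} (hq : 0 < q) (hq1 : q < 1)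
    (hsm : ∀ x y y', hammingDist y y' = 1 → q * p x y ≤ p x y') (W : A → Set (Fin n → Y))
    {β : ℝ} (hβ : 0 < β) :
    mass (fun ω : A × (Fin n → Y) => p ω.1 ω.2)
        {ω | β * n < (badPositions (W ω.1) ω.2).ncard}
      ≤ Fintype.card Y / q / β * ∑ x, ∑ y, (W x).indicator (p x) y := by
  classical
  have hW : 0 ≤ ∑ x, ∑ y, (W x).indicator (p x) y :=
    Finset.sum_nonneg fun x _ => Finset.sum_nonneg fun y _ =>
      Set.indicator_nonneg (fun y _ => hp x y) _
  -- For `n = 0` the Markov threshold `β * n` is zero and cannot be divided by, but there are no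
  -- positions at all.
  rcases Nat.eq_zero_or_pos n with rfl | hn
  · have : {ω : A × (Fin 0 → Y) | β * (0 : ℕ) < (badPositions (W ω.1) ω.2).ncard} = ∅ := by
      ext ω
      simp [Set.eq_empty_of_isEmpty (badPositions (W ω.1) ω.2)]
    rw [this]
    simp only [mass, Set.indicator_empty, Finset.sum_const_zero]
    positivity
  have hn' : (0 : ℝ) < n := by exact_mod_cast hn
  have h1 := mul_mass_lt_le (p := fun ω : A × (Fin n → Y) => p ω.1 ω.2) (fun ω => hp _ _)
    (fun ω => ((badPositions (W ω.1) ω.2).ncard : ℝ)) (fun ω => Nat.cast_nonneg _) (β * n)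
  rw [Fintype.sum_prod_type] at h1
  have h2 := h1.trans (sum_badPositions_le p hp hq hq1 hsm W)
  rw [mul_comm, ← le_div_iff₀ (by positivity)] at h2
  refine h2.trans (le_of_eq ?_)
  field_simp

/-- For a sensitive function `f`, two words that are indistinguishable for an approximation `g` of
`f` can differ only in positions where a modification of `y` makes `g` incorrect. -/
theorem hammingDist_le_badPositions {X Y Z : Type*} [DecidableEq X] {n : ℕ}
    {f : (Fin n → X) → (Fin n → Y) → Z} (hf : SensitiveGivenRight f)
    (g : (Fin n → X) → (Fin n → Y) → Z) {x x' : Fin n → X} (y : Fin n → Y)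
    (hg : ∀ y, g x y = g x' y) :
    hammingDist x x' ≤ (badPositions {y | f x y ≠ g x y} y).ncard
      + (badPositions {y | f x' y ≠ g x' y} y).ncard := by
  classical
  refine le_trans ?_ (Set.ncard_union_le _ _)
  rw [hammingDist, ← Set.ncard_coe_finset]
  refine Set.ncard_le_ncard (fun i hi => ?_) (Set.toFinite _)
  have hi' : x i ≠ x' i := by simpa using hi
  by_contra hcon
  simp only [badPositions, Set.mem_union, Set.mem_ofPred_eq, not_or, not_exists, not_not,
    ne_eq] at hcon
  obtain ⟨h1, h2⟩ := hcon
  -- At a position that is bad for neither word, `f` agrees with `g` on all modifications of `y`,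
  -- including `y` itself, so `f` does not separate `x` from `x'` there, against sensitivity.
  have heq : ∀ b, f x (Function.update y i b) = f x' (Function.update y i b) := fun b => by
    rw [h1, h2, hg]
  obtain ⟨y', -, hy', hne⟩ := hf x x' y i (by simpa using heq (y i)) hi'
  apply hne
  have : y' = Function.update y i (y' i) := by
    ext j
    by_cases hj : j = i
    · subst hj; simp
    · simp [hj, hy' j hj]
  rw [this]
  exact heq _

/-! ### Robust pairs of a code -/

section Source

variable {X Y : Type*}

/-- The joint distribution as a weight on pairs. -/
noncomputable def Source.weight (P : Source X Y) (n : ℕ)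
    (ω : (Fin n → X) × (Fin n → Y)) : ℝ :=
  P.prob ω.1 ω.2

theorem Source.weight_nonneg (P : Source X Y) (n : ℕ) (ω) : 0 ≤ P.weight n ω :=
  ENNReal.toReal_nonneg

variable [Fintype X] [Fintype Y]

theorem Source.sum_weight (P : Source X Y) (n : ℕ) : ∑ ω, P.weight n ω = 1 := by
  have h := (P n).tsum_coe
  rw [tsum_fintype] at h
  simp only [weight, prob]
  rw [← ENNReal.toReal_sum fun ω _ => (P n).apply_ne_top ω, h, ENNReal.toReal_one]

theorem Source.sum_prob (P : Source X Y) (n : ℕ) :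
    ∑ x : Fin n → X, ∑ y : Fin n → Y, P.prob x y = 1 := by
  rw [← P.sum_weight n, Fintype.sum_prod_type]
  rfl

theorem Code.errorProb_eq_mass (P : Source X Y) {n : ℕ} {Z : Type*} (c : Code X Y n Z)
    (f : (Fin n → X) → (Fin n → Y) → Z) :
    c.errorProb P f = mass (P.weight n) {ω | f ω.1 ω.2 ≠ c.dec (c.enc₁ ω.1) (c.enc₂ ω.2)} := by
  classical
  rw [mass, Fintype.sum_prod_type, Code.errorProb]
  refine Finset.sum_congr rfl fun x _ => Finset.sum_congr rfl fun y _ => ?_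
  simp only [Set.indicator_apply, Source.weight, Set.mem_ofPred_eq]

/-- Pairs on which a code for a totally sensitive function is correct and robust. Given the
codeword of one component and the other component, such pairs are close to each other. -/
theorem exists_robustSet [DecidableEq X] [DecidableEq Y] (P : Source X Y) {n : ℕ} {Z : Type*}
    {q₁ q₂ : ℝ} (hq₁ : 0 < q₁) (hq₁' : q₁ < 1) (hq₂ : 0 < q₂) (hq₂' : q₂ < 1)
    (hsm₁ : ∀ (x x' : Fin n → X) (y : Fin n → Y),
      hammingDist x x' = 1 → q₁ * P.prob x y ≤ P.prob x' y)
    (hsm₂ : ∀ (x : Fin n → X) (y y' : Fin n → Y),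
      hammingDist y y' = 1 → q₂ * P.prob x y ≤ P.prob x y')
    {f : (Fin n → X) → (Fin n → Y) → Z} (hl : SensitiveGivenLeft f) (hr : SensitiveGivenRight f)
    (c : Code X Y n Z) {β : ℝ} (hβ : 0 < β) :
    ∃ G : Set ((Fin n → X) × (Fin n → Y)),
      mass (P.weight n) Gᶜ ≤ c.errorProb P f
        + (Fintype.card X / q₁ / β * c.errorProb P f
          + Fintype.card Y / q₂ / β * c.errorProb P f) ∧
      (∀ ω ∈ G, f ω.1 ω.2 = c.dec (c.enc₁ ω.1) (c.enc₂ ω.2)) ∧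
      (∀ x x' y, (x, y) ∈ G → (x', y) ∈ G → c.enc₁ x = c.enc₁ x' →
        (hammingDist x x' : ℝ) ≤ 2 * β * n) ∧
      (∀ x y y', (x, y) ∈ G → (x, y') ∈ G → c.enc₂ y = c.enc₂ y' →
        (hammingDist y y' : ℝ) ≤ 2 * β * n) := by
  classical
  set g : (Fin n → X) → (Fin n → Y) → Z := fun x y => c.dec (c.enc₁ x) (c.enc₂ y) with hg
  set E₀ : Set ((Fin n → X) × (Fin n → Y)) := {ω | f ω.1 ω.2 ≠ g ω.1 ω.2}
  set E₁ : Set ((Fin n → X) × (Fin n → Y)) :=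
    {ω | β * n < (badPositions {x | f x ω.2 ≠ g x ω.2} ω.1).ncard}
  set E₂ : Set ((Fin n → X) × (Fin n → Y)) :=
    {ω | β * n < (badPositions {y | f ω.1 y ≠ g ω.1 y} ω.2).ncard}
  have hp : ∀ ω, 0 ≤ P.weight n ω := P.weight_nonneg n
  have hp' : ∀ x y, 0 ≤ P.prob (n := n) x y := fun x y => hp (x, y)
  have he : c.errorProb P f = ∑ x, ∑ y, {y | f x y ≠ g x y}.indicator (P.prob x) y := by
    rw [Code.errorProb]
    refine Finset.sum_congr rfl fun x _ => Finset.sum_congr rfl fun y _ => ?_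
    simp only [Set.indicator_apply, Set.mem_ofPred_eq, hg]
  have he' : c.errorProb P f
      = ∑ y, ∑ x, {x | f x y ≠ g x y}.indicator (fun x => P.prob x y) x := by
    rw [he, Finset.sum_comm]
    rfl
  have h2 := mass_many_badPositions_le P.prob hp' hq₂ hq₂' hsm₂
    (fun x => {y | f x y ≠ g x y}) hβ
  have h1 := mass_many_badPositions_le (fun y x => P.prob (n := n) x y) (fun y x => hp' x y)
    hq₁ hq₁' (fun y x x' h => hsm₁ x x' y h) (fun y => {x | f x y ≠ g x y}) hβ
  rw [← he] at h2
  rw [← he'] at h1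
  have h1' : mass (P.weight n) E₁ ≤ Fintype.card X / q₁ / β * c.errorProb P f := by
    refine le_trans (le_of_eq ?_) h1
    rw [mass, mass]
    exact Fintype.sum_equiv (Equiv.prodComm _ _) _ _ fun ω => rfl
  refine ⟨(E₀ ∪ (E₁ ∪ E₂))ᶜ, ?_, ?_, ?_, ?_⟩
  · rw [compl_compl]
    refine (mass_union_le hp _ _).trans (add_le_add (c.errorProb_eq_mass P f).ge ?_)
    exact (mass_union_le hp _ _).trans (add_le_add h1' h2)
  · intro ω hω
    by_contra h
    exact hω (Or.inl h)
  · intro x x' y hx hx' hxx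
    have hb := hammingDist_le_badPositions hr g (x := x) (x' := x') y (fun y => by simp [hg, hxx])
    have k1 : ¬ β * n < (badPositions {y | f x y ≠ g x y} y).ncard :=
      fun h => hx (Or.inr (Or.inr h))
    have k2 : ¬ β * n < (badPositions {y | f x' y ≠ g x' y} y).ncard :=
      fun h => hx' (Or.inr (Or.inr h))
    have hb' : (hammingDist x x' : ℝ) ≤ (badPositions {y | f x y ≠ g x y} y).ncard
      + (badPositions {y | f x' y ≠ g x' y} y).ncard := by exact_mod_cast hb
    linarith
  · intro x y y' hy hy' hyy
    -- The two sensitivity conditions are definitionally the same after swapping the arguments.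
    have hl' : SensitiveGivenRight (fun y x => f x y) := hl
    have hb := hammingDist_le_badPositions hl' (fun y x => g x y) (x := y) (x' := y') x
      (fun x => by simp [hg, hyy])
    have k1 : ¬ β * n < (badPositions {x | f x y ≠ g x y} x).ncard :=
      fun h => hy (Or.inr (Or.inl h))
    have k2 : ¬ β * n < (badPositions {x | f x y' ≠ g x y'} x).ncard :=
      fun h => hy' (Or.inr (Or.inl h))
    have hb' : (hammingDist y y' : ℝ) ≤ (badPositions {x | f x y ≠ g x y} x).ncard
      + (badPositions {x | f x y' ≠ g x y'} x).ncard := by exact_mod_cast hb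
    linarith

end Source

/-! ### Appending bits to prefix codes -/

section Bits

variable {A : Type*} {e : A → List Bool} {k : ℕ} {h : A → Fin k → Bool}

theorem append_ofFn_inj {a b : A} :
    e a ++ List.ofFn (h a) = e b ++ List.ofFn (h b) ↔ e a = e b ∧ h a = h b := by
  constructor
  · intro hab
    obtain ⟨h1, h2⟩ := List.append_inj' hab (by simp)
    exact ⟨h1, List.ofFn_injective h2⟩
  · rintro ⟨h1, h2⟩
    rw [h1, h2]

/-- Both `e a` and `e b` are prefixes of one word, hence comparable and so equal; the appended
blocks have the common length `k`. -/
theorem PrefixFree.append_ofFn (he : PrefixFree e) (h : A → Fin k → Bool) :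
    PrefixFree fun a => e a ++ List.ofFn (h a) := by
  intro a b hab
  have hae : e a <+: e b ++ List.ofFn (h b) := (List.prefix_append _ _).trans hab
  have hab' : e a = e b := by
    rcases List.prefix_or_prefix_of_prefix hae (List.prefix_append (e b) _) with h1 | h1
    · exact he a b h1
    · exact (he b a h1).symm
  exact hab.eq_of_length (by simp [hab'])

theorem prefixFree_ofFn (h : A → Fin k → Bool) : PrefixFree fun a => List.ofFn (h a) :=
  fun _ _ hab => hab.eq_of_length (by simp)

theorem exists_injective_bits (A : Type*) [Fintype A] {k : ℕ} (hk : Fintype.card A ≤ 2 ^ k) :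
    ∃ h : A → Fin k → Bool, Function.Injective h := by
  obtain ⟨h⟩ := Function.Embedding.nonempty_of_card_le (α := A) (β := Fin k → Bool)
    (by simpa using hk)
  exact ⟨h, h.injective⟩

end Bits

/-! ### Slepian-Wolf codes by binning -/

section Coding

variable {X Y : Type*} [Fintype X] [Fintype Y]

/-- Decoding to an element of `G` that is consistent with both codewords. -/
theorem exists_code_of_set (P : Source X Y) {n : ℕ} {e₁ : (Fin n → X) → List Bool}
    {e₂ : (Fin n → Y) → List Bool} (h₁ : PrefixFree e₁) (h₂ : PrefixFree e₂)
    (G B : Set ((Fin n → X) × (Fin n → Y)))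
    (hG : ∀ ω ∈ G, ω ∉ B → ∀ ω' ∈ G, e₁ ω'.1 = e₁ ω.1 → e₂ ω'.2 = e₂ ω.2 → ω' = ω) :
    ∃ c : Code X Y n ((Fin n → X) × (Fin n → Y)), c.enc₁ = e₁ ∧ c.enc₂ = e₂ ∧
      c.errorProb P (fun x y => (x, y)) ≤ mass (P.weight n) Gᶜ + mass (P.weight n) B := by
  classical
  -- Default output when no pair of `G` matches; the support of a distribution supplies one.
  obtain ⟨ω₀, -⟩ := (P n).support_nonempty
  let dec : List Bool → List Bool → (Fin n → X) × (Fin n → Y) := fun s t =>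
    if h : ∃ ω ∈ G, e₁ ω.1 = s ∧ e₂ ω.2 = t then h.choose else ω₀
  refine ⟨⟨e₁, e₂, dec, h₁, h₂⟩, rfl, rfl, ?_⟩
  rw [Code.errorProb_eq_mass]
  refine le_trans (mass_mono (P.weight_nonneg n) ?_) (mass_union_le (P.weight_nonneg n) _ _)
  intro ω hω
  by_contra hcon
  simp only [Set.mem_union, Set.mem_compl_iff, not_or, not_not] at hcon
  obtain ⟨hωG, hωB⟩ := hcon
  have hex : ∃ ω' ∈ G, e₁ ω'.1 = e₁ ω.1 ∧ e₂ ω'.2 = e₂ ω.2 := ⟨ω, hωG, rfl, rfl⟩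
  apply hω
  change ω = dec (e₁ ω.1) (e₂ ω.2)
  simp only [dec, dif_pos hex]
  obtain ⟨k1, k2, k3⟩ := hex.choose_spec
  exact (hG ω hωG hωB _ k1 k2 k3).symm

/-- Random binning for a source, with `k` bits. -/
theorem exists_binning (P : Source X Y) {n : ℕ} {A : Type*} [Fintype A] {k : ℕ} {M : ℝ}
    (hk : (n + 1) * M ≤ 2 ^ k) (a : (Fin n → X) × (Fin n → Y) → A)
    (S : (Fin n → X) × (Fin n → Y) → Set A) (hM : ∀ ω, ((S ω).ncard : ℝ) ≤ M) :
    ∃ h : A → Fin k → Bool,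
      mass (P.weight n) {ω | ∃ a' ∈ S ω, a' ≠ a ω ∧ h a' = h (a ω)} ≤ 1 / (n + 1) := by
  obtain ⟨h, hh⟩ := exists_hash (Fin k → Bool) (P.weight n) (P.weight_nonneg n) a S M hM
  refine ⟨h, hh.trans ?_⟩
  rw [P.sum_weight, one_mul]
  have hc : (Fintype.card (Fin k → Bool) : ℝ) = 2 ^ k := by simp
  rw [hc, div_le_div_iff₀ (by positivity) (by positivity)]
  linarith

/-- A matching inside a fibre of `f`, once enumerated, is a diagonal family. -/
theorem ncard_le_maxEQ {n : ℕ} {Z : Type*} (f : (Fin n → X) → (Fin n → Y) → Z) (z : Z)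
    (M : Set ((Fin n → X) × (Fin n → Y))) (hM : ∀ ω ∈ M, f ω.1 ω.2 = z)
    (h₁ : Set.InjOn Prod.fst M) (h₂ : Set.InjOn Prod.snd M) : M.ncard ≤ maxEQ f := by
  refine le_trans ?_ (le_ciSup (bddAbove_range_EQ f) z)
  refine le_csSup (EQ_mem f z).1 ?_
  let e : Fin M.ncard ≃ M := (Finite.equivFin M).symm
  refine ⟨fun i => (e i).1.1, fun i => (e i).1.2, fun i j hij => ?_, fun i j hij => ?_,
    fun i => hM _ (e i).2⟩
  · exact e.injective (Subtype.ext (h₁ (e i).2 (e j).2 hij))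
  · exact e.injective (Subtype.ext (h₂ (e i).2 (e j).2 hij))

variable {n : ℕ} {Z : Type*} {f : (Fin n → X) → (Fin n → Y) → Z} {c : Code X Y n Z}
  {G : Set ((Fin n → X) × (Fin n → Y))} {L : ℝ} {k : ℕ}

/-- The first hash isolates `x` among the left vertices compatible with both codewords, the second
isolates `y` given `x`. The `l` bits pay for the matching size, the `k` bits for the conditional
lists. -/
theorem exists_code_both (P : Source X Y) (hL : 1 ≤ L) (hk : (n + 1) * L ≤ 2 ^ k) {l : ℕ}
    (hl : 2 * (maxEQ f : ℝ) ≤ 2 ^ l)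
    (hG : ∀ ω ∈ G, f ω.1 ω.2 = c.dec (c.enc₁ ω.1) (c.enc₂ ω.2))
    (hX : ∀ s y, ({x | (x, y) ∈ G ∧ c.enc₁ x = s}.ncard : ℝ) ≤ L)
    (hY : ∀ x t, ({y | (x, y) ∈ G ∧ c.enc₂ y = t}.ncard : ℝ) ≤ L) :
    ∃ (c' : Code X Y n ((Fin n → X) × (Fin n → Y))) (h₁ : (Fin n → X) → Fin (l + k) → Bool)
      (h₂ : (Fin n → Y) → Fin k → Bool),
      c'.enc₁ = (fun x => c.enc₁ x ++ List.ofFn (h₁ x)) ∧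
      c'.enc₂ = (fun y => c.enc₂ y ++ List.ofFn (h₂ y)) ∧
      c'.errorProb P (fun x y => (x, y)) ≤ mass (P.weight n) Gᶜ + 2 / (n + 1) := by
  let E : List Bool → List Bool → Set ((Fin n → X) × (Fin n → Y)) := fun s t =>
    {ω | ω ∈ G ∧ c.enc₁ ω.1 = s ∧ c.enc₂ ω.2 = t}
  have hE : ∀ s t, ((Prod.fst '' E s t).ncard : ℝ) ≤ maxEQ f + maxEQ f * L := by
    intro s t
    refine ncard_image_fst_le (E s t) (maxEQ f) L (by linarith) (fun y => ?_)
      fun M hM h1 h2 => ?_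
    · refine le_trans ?_ (hX s y)
      have hsub : {x | (x, y) ∈ E s t} ⊆ {x | (x, y) ∈ G ∧ c.enc₁ x = s} :=
        fun x hx => ⟨hx.1, hx.2.1⟩
      exact_mod_cast Set.ncard_le_ncard hsub (Set.toFinite _)
    · refine ncard_le_maxEQ f (c.dec s t) M (fun ω hω => ?_) h1 h2
      obtain ⟨k1, k2, k3⟩ := hM hω
      rw [hG ω k1, k2, k3]
  obtain ⟨h₁, hh₁⟩ := exists_binning P (k := l + k) (M := maxEQ f + maxEQ f * L) (by
      rw [pow_add]
      have h0 : (0 : ℝ) ≤ maxEQ f := Nat.cast_nonneg _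
      have hn : (0 : ℝ) ≤ n := Nat.cast_nonneg _
      calc (n + 1) * ((maxEQ f : ℝ) + maxEQ f * L)
          ≤ (n + 1) * (maxEQ f * L + maxEQ f * L) := by
            gcongr
            -- `J + J * L ≤ 2 * J * L` because `L ≥ 1`; this is the factor 2 in `hl`.
            exact le_mul_of_one_le_right h0 hL
        _ = 2 * maxEQ f * ((n + 1) * L) := by ring
        _ ≤ 2 ^ l * 2 ^ k := mul_le_mul hl hk (by positivity) (by positivity)) Prod.fst
    (fun ω => Prod.fst '' E (c.enc₁ ω.1) (c.enc₂ ω.2)) (fun ω => hE _ _)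
  obtain ⟨h₂, hh₂⟩ := exists_binning P hk Prod.snd
    (fun ω => {y | (ω.1, y) ∈ G ∧ c.enc₂ y = c.enc₂ ω.2}) (fun ω => hY _ _)
  obtain ⟨c', hc1, hc2, hc3⟩ := exists_code_of_set P (c.prefixFree₁.append_ofFn h₁)
    (c.prefixFree₂.append_ofFn h₂) G
    ({ω | ∃ a' ∈ Prod.fst '' E (c.enc₁ ω.1) (c.enc₂ ω.2), a' ≠ ω.1 ∧ h₁ a' = h₁ ω.1}
      ∪ {ω | ∃ a' ∈ {y | (ω.1, y) ∈ G ∧ c.enc₂ y = c.enc₂ ω.2}, a' ≠ ω.2 ∧ h₂ a' = h₂ ω.2})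
    (fun ω hω hB ω' hω' he1 he2 => by
      rw [append_ofFn_inj] at he1 he2
      by_contra hne
      apply hB
      by_cases hx : ω'.1 = ω.1
      · refine Or.inr ⟨ω'.2, ⟨hx ▸ hω', he2.1⟩, fun hy => hne (Prod.ext hx hy), he2.2⟩
      · exact Or.inl ⟨ω'.1, ⟨ω', ⟨hω', he1.1, he2.1⟩, rfl⟩, hx, he1.2⟩)
  refine ⟨c', h₁, h₂, hc1, hc2, hc3.trans ?_⟩
  have := mass_union_le (P.weight_nonneg n) _ _ |>.trans (add_le_add hh₁ hh₂)
  have h2 : (2 : ℝ) / (n + 1) = 1 / (n + 1) + 1 / (n + 1) := by ring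
  rw [h2]
  gcongr

/-- With `y` sent in full, only the list of `x` given `y` and its codeword needs hashing, so no
matching bound enters. -/
theorem exists_code_left (P : Source X Y) (hk : (n + 1) * L ≤ 2 ^ k) {m : ℕ}
    (hm : Fintype.card (Fin n → Y) ≤ 2 ^ m)
    (hX : ∀ s y, ({x | (x, y) ∈ G ∧ c.enc₁ x = s}.ncard : ℝ) ≤ L) :
    ∃ (c' : Code X Y n ((Fin n → X) × (Fin n → Y))) (h₁ : (Fin n → X) → Fin k → Bool)
      (h₂ : (Fin n → Y) → Fin m → Bool),
      c'.enc₁ = (fun x => c.enc₁ x ++ List.ofFn (h₁ x)) ∧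
      c'.enc₂ = (fun y => List.ofFn (h₂ y)) ∧
      c'.errorProb P (fun x y => (x, y)) ≤ mass (P.weight n) Gᶜ + 1 / (n + 1) := by
  obtain ⟨h₁, hh₁⟩ := exists_binning P hk Prod.fst
    (fun ω => {x | (x, ω.2) ∈ G ∧ c.enc₁ x = c.enc₁ ω.1}) (fun ω => hX _ _)
  obtain ⟨h₂, hh₂⟩ := exists_injective_bits (Fin n → Y) hm
  obtain ⟨c', hc1, hc2, hc3⟩ := exists_code_of_set P (c.prefixFree₁.append_ofFn h₁)
    (prefixFree_ofFn h₂) G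
    {ω | ∃ a' ∈ {x | (x, ω.2) ∈ G ∧ c.enc₁ x = c.enc₁ ω.1}, a' ≠ ω.1 ∧ h₁ a' = h₁ ω.1}
    (fun ω hω hB ω' hω' he1 he2 => by
      rw [append_ofFn_inj] at he1
      have hy : ω'.2 = ω.2 := hh₂ (List.ofFn_injective he2)
      by_contra hne
      exact hB ⟨ω'.1, ⟨hy ▸ hω', he1.1⟩, fun hx => hne (Prod.ext hx hy), he1.2⟩)
  exact ⟨c', h₁, h₂, hc1, hc2, hc3.trans (by gcongr)⟩

theorem exists_code_right (P : Source X Y) (hk : (n + 1) * L ≤ 2 ^ k) {m : ℕ}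
    (hm : Fintype.card (Fin n → X) ≤ 2 ^ m)
    (hY : ∀ x t, ({y | (x, y) ∈ G ∧ c.enc₂ y = t}.ncard : ℝ) ≤ L) :
    ∃ (c' : Code X Y n ((Fin n → X) × (Fin n → Y))) (h₁ : (Fin n → X) → Fin m → Bool)
      (h₂ : (Fin n → Y) → Fin k → Bool),
      c'.enc₁ = (fun x => List.ofFn (h₁ x)) ∧
      c'.enc₂ = (fun y => c.enc₂ y ++ List.ofFn (h₂ y)) ∧
      c'.errorProb P (fun x y => (x, y)) ≤ mass (P.weight n) Gᶜ + 1 / (n + 1) := by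
  obtain ⟨h₂, hh₂⟩ := exists_binning P hk Prod.snd
    (fun ω => {y | (ω.1, y) ∈ G ∧ c.enc₂ y = c.enc₂ ω.2}) (fun ω => hY _ _)
  obtain ⟨h₁, hh₁⟩ := exists_injective_bits (Fin n → X) hm
  obtain ⟨c', hc1, hc2, hc3⟩ := exists_code_of_set P (prefixFree_ofFn h₁)
    (c.prefixFree₂.append_ofFn h₂) G
    {ω | ∃ a' ∈ {y | (ω.1, y) ∈ G ∧ c.enc₂ y = c.enc₂ ω.2}, a' ≠ ω.2 ∧ h₂ a' = h₂ ω.2}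
    (fun ω hω hB ω' hω' he1 he2 => by
      rw [append_ofFn_inj] at he2
      have hx : ω'.1 = ω.1 := hh₁ (List.ofFn_injective he1)
      by_contra hne
      exact hB ⟨ω'.2, ⟨hx ▸ hω', he2.1⟩, fun hy => hne (Prod.ext hx hy), he2.2⟩)
  exact ⟨c', h₁, h₂, hc1, hc2, hc3.trans (by gcongr)⟩

theorem avgLength₁_append (P : Source X Y) {Z' : Type*} {c' : Code X Y n Z'}
    {h : (Fin n → X) → Fin k → Bool} (hc : c'.enc₁ = fun x => c.enc₁ x ++ List.ofFn (h x)) :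
    c'.avgLength₁ P = c.avgLength₁ P + k := by
  have hs := P.sum_prob n
  simp only [Code.avgLength₁, hc, List.length_append, List.length_ofFn, Nat.cast_add, mul_add,
    Finset.sum_add_distrib, ← Finset.sum_mul, hs, one_mul]

theorem avgLength₂_append (P : Source X Y) {Z' : Type*} {c' : Code X Y n Z'}
    {h : (Fin n → Y) → Fin k → Bool} (hc : c'.enc₂ = fun y => c.enc₂ y ++ List.ofFn (h y)) :
    c'.avgLength₂ P = c.avgLength₂ P + k := by
  have hs := P.sum_prob n
  rw [Finset.sum_comm] at hs
  simp only [Code.avgLength₂, hc, List.length_append, List.length_ofFn, Nat.cast_add, mul_add,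
    Finset.sum_add_distrib, ← Finset.sum_mul, hs, one_mul]

theorem avgLength₁_ofFn (P : Source X Y) {Z' : Type*} {c' : Code X Y n Z'}
    {h : (Fin n → X) → Fin k → Bool} (hc : c'.enc₁ = fun x => List.ofFn (h x)) :
    c'.avgLength₁ P = k := by
  have hs := P.sum_prob n
  simp only [Code.avgLength₁, hc, List.length_ofFn, ← Finset.sum_mul, hs, one_mul]

theorem avgLength₂_ofFn (P : Source X Y) {Z' : Type*} {c' : Code X Y n Z'}
    {h : (Fin n → Y) → Fin k → Bool} (hc : c'.enc₂ = fun y => List.ofFn (h y)) :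
    c'.avgLength₂ P = k := by
  have hs := P.sum_prob n
  rw [Finset.sum_comm] at hs
  simp only [Code.avgLength₂, hc, List.length_ofFn, ← Finset.sum_mul, hs, one_mul]

theorem avgLength₁_nonneg (P : Source X Y) (c : Code X Y n Z) : 0 ≤ c.avgLength₁ P :=
  Finset.sum_nonneg fun _ _ => mul_nonneg
    (Finset.sum_nonneg fun _ _ => P.weight_nonneg n (_, _)) (Nat.cast_nonneg _)

theorem avgLength₂_nonneg (P : Source X Y) (c : Code X Y n Z) : 0 ≤ c.avgLength₂ P :=
  Finset.sum_nonneg fun _ _ => mul_nonneg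
    (Finset.sum_nonneg fun _ _ => P.weight_nonneg n (_, _)) (Nat.cast_nonneg _)

end Coding

/-! ### Upper limits in `EReal` -/

section Limsup

variable {u v w : ℕ → ℝ} {a b : ℝ}

/-- Reduces `EReal` upper limits to eventual real inequalities, with no boundedness to check. -/
theorem limsup_coe_le_iff : limsup (fun n => (u n : EReal)) atTop ≤ (a : EReal) ↔
    ∀ ε > 0, ∀ᶠ n in atTop, u n ≤ a + ε := by
  constructor
  · intro h ε hε
    have hlt : limsup (fun n => (u n : EReal)) atTop < ((a + ε : ℝ) : EReal) :=
      h.trans_lt (by exact_mod_cast lt_add_of_pos_right a hε)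
    filter_upwards [eventually_lt_of_limsup_lt hlt] with n hn
    exact_mod_cast hn.le
  · intro h
    refine EReal.le_of_forall_lt_iff_le.1 fun z hz => ?_
    have hz' : a < z := by exact_mod_cast hz
    refine limsup_le_of_le (h := ?_)
    filter_upwards [h (z - a) (sub_pos.2 hz')] with n hn
    exact_mod_cast hn.trans (by linarith)

theorem limsup_le_add (hu : limsup (fun n => (u n : EReal)) atTop ≤ (a : EReal))
    (hv : limsup (fun n => (v n : EReal)) atTop ≤ (b : EReal))
    (hw : ∀ᶠ n in atTop, w n ≤ u n + v n) :
    limsup (fun n => (w n : EReal)) atTop ≤ ((a + b : ℝ) : EReal) := by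
  rw [limsup_coe_le_iff] at *
  intro ε hε
  filter_upwards [hu (ε / 2) (by positivity), hv (ε / 2) (by positivity), hw] with n h1 h2 h3
  linarith

theorem limsup_le_of_tendsto (h : Tendsto u atTop (nhds a)) :
    limsup (fun n => (u n : EReal)) atTop ≤ (a : EReal) :=
  limsup_coe_le_iff.2 fun ε hε => h.eventually_le_const (by linarith)

theorem nonneg_of_limsup_le (hu : ∀ n, 0 ≤ u n)
    (h : limsup (fun n => (u n : EReal)) atTop ≤ (a : EReal)) : 0 ≤ a := by
  refine le_of_forall_pos_le_add fun ε hε => ?_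
  obtain ⟨n, hn⟩ := (limsup_coe_le_iff.1 h ε hε).exists
  exact (hu n).trans hn

end Limsup

/-! ### Counting the extra bits -/

section Bits

theorem le_two_pow_ceil_logb (x : ℝ) : x ≤ 2 ^ ⌈Real.logb 2 x⌉₊ := by
  rcases le_or_gt x 0 with hx | hx
  · exact hx.trans (by positivity)
  · rw [← Real.rpow_natCast, ← Real.logb_le_iff_le_rpow (by norm_num) hx]
    exact Nat.le_ceil _

theorem logb_ballBound {A β : ℝ} (hA : 0 ≤ A) (hβ : 0 < β) (n : ℕ) :
    Real.logb 2 (ballBound A β n)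
      = n * (-(2 * (β * Real.log β) / Real.log 2) + Real.log (1 + A * β) / Real.log 2) := by
  have h1 : 0 < 1 + A * β := by positivity
  rw [Real.logb, ballBound, Real.log_mul (Real.rpow_pos_of_pos hβ _).ne' (by positivity),
    Real.log_rpow hβ, Real.log_pow]
  ring

theorem tendsto_log_succ_div : Tendsto (fun n : ℕ => Real.log (n + 1) / n) atTop (nhds 0) := by
  have h1 : Tendsto (fun n : ℕ => Real.log ((n : ℝ) + 1) / ((n : ℝ) + 1)) atTop (nhds 0) :=
    (Real.isLittleO_log_id_atTop.tendsto_div_nhds_zero).comp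
      (tendsto_atTop_add_const_right _ 1 tendsto_natCast_atTop_atTop)
  have h2 : Tendsto (fun n : ℕ => 2 * (Real.log ((n : ℝ) + 1) / ((n : ℝ) + 1))) atTop
      (nhds 0) := by simpa using h1.const_mul 2
  refine squeeze_zero' (Eventually.of_forall fun n => ?_) ?_ h2
  · exact div_nonneg (Real.log_nonneg (by simp)) (Nat.cast_nonneg _)
  · filter_upwards [eventually_ge_atTop 1] with n hn
    have hn' : (1 : ℝ) ≤ n := by exact_mod_cast hn
    have hl : 0 ≤ Real.log ((n : ℝ) + 1) := Real.log_nonneg (by linarith)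
    rw [← mul_div_assoc, div_le_div_iff₀ (by linarith) (by linarith)]
    nlinarith

theorem exists_subexponential_bits {A : ℝ} (hA : 0 ≤ A) {β : ℕ → ℝ} (hβ : ∀ n, 0 < β n)
    (hβ1 : ∀ n, β n ≤ 1) (hβ0 : Tendsto β atTop (nhds 0)) :
    ∃ k : ℕ → ℕ, (∀ n : ℕ, ((n : ℝ) + 1) * ballBound A (β n) n ≤ 2 ^ k n) ∧
      Tendsto (fun n : ℕ => 1 / (n : ℝ) * (k n : ℝ)) atTop (nhds 0) := by
  refine ⟨fun n => ⌈Real.logb 2 (((n : ℝ) + 1) * ballBound A (β n) n)⌉₊,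
    fun n => le_two_pow_ceil_logb _, ?_⟩
  -- The exponent of `ballBound` per letter. It is continuous at `0` with value `0`, since `β * log
  -- β` is.
  set ρ : ℝ → ℝ := fun β =>
    -(2 * (β * Real.log β) / Real.log 2) + Real.log (1 + A * β) / Real.log 2 with hρ
  have hρ0 : Tendsto (fun n => ρ (β n)) atTop (nhds 0) := by
    have hcont : ContinuousAt ρ 0 := by
      have h1 : ContinuousAt (fun β : ℝ => β * Real.log β) 0 :=
        Real.continuous_mul_log.continuousAt
      have h2 : ContinuousAt (fun β : ℝ => Real.log (1 + A * β)) 0 :=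
        ContinuousAt.log (by fun_prop) (by simp)
      exact (((h1.const_mul 2).div_const _).neg).add (h2.div_const _)
    have hρz : ρ 0 = 0 := by simp [hρ]
    have := hcont.tendsto.comp hβ0
    rwa [hρz] at this
  have hlim : Tendsto (fun n : ℕ => Real.log (n + 1) / n / Real.log 2 + ρ (β n) + 1 / (n : ℝ))
      atTop (nhds 0) := by
    simpa using ((tendsto_log_succ_div.div_const (Real.log 2)).add hρ0).add
      tendsto_one_div_atTop_nhds_zero_nat
  refine squeeze_zero' (Eventually.of_forall fun n => by positivity) ?_ hlim
  filter_upwards [eventually_ge_atTop 1] with n hn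
  have hn' : (0 : ℝ) < n := by exact_mod_cast hn
  have hB := one_le_ballBound hA (hβ n) (hβ1 n) n
  have hlog : Real.logb 2 (((n : ℝ) + 1) * ballBound A (β n) n)
      = Real.log (n + 1) / Real.log 2 + n * ρ (β n) := by
    rw [Real.logb_mul (by positivity) (by linarith), logb_ballBound hA (hβ n)]
    rfl
  have hc := (Nat.ceil_lt_add_one (Real.logb_nonneg (b := 2) (by norm_num)
    (x := ((n : ℝ) + 1) * ballBound A (β n) n) (by nlinarith))).le
  rw [hlog] at hc
  rw [hlog]
  calc 1 / (n : ℝ) * (⌈Real.log (n + 1) / Real.log 2 + n * ρ (β n)⌉₊ : ℝ)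
      ≤ 1 / (n : ℝ) * (Real.log (n + 1) / Real.log 2 + n * ρ (β n) + 1) := by gcongr
    _ = _ := by field_simp

/-- One extra bit for the doubling and one for rounding up; `J = 0` is covered by the convention
`logb 2 0 = 0`. -/
theorem ceil_logb_two_mul_le (J : ℕ) :
    (⌈Real.logb 2 (2 * (J : ℝ))⌉₊ : ℝ) ≤ Real.logb 2 J + 2 := by
  rcases Nat.eq_zero_or_pos J with rfl | hJ
  · simp
  · have hJ' : (1 : ℝ) ≤ J := by exact_mod_cast hJ
    have h := (Nat.ceil_lt_add_one (Real.logb_nonneg (b := 2) (by norm_num)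
      (x := 2 * (J : ℝ)) (by linarith))).le
    have h2 : Real.logb 2 (2 * (J : ℝ)) = 1 + Real.logb 2 J := by
      rw [Real.logb_mul (by norm_num) (by positivity), Real.logb_self_eq_one (by norm_num)]
    rw [h2] at h
    rw [h2]
    linarith

theorem exists_bits_limsup_le {J : ℕ → ℕ} {r : ℝ}
    (h : limsup (fun n : ℕ => ((1 / (n : ℝ) * Real.logb 2 (J n : ℝ) : ℝ) : EReal)) atTop
      ≤ (r : EReal)) :
    ∃ l : ℕ → ℕ, (∀ n, 2 * (J n : ℝ) ≤ 2 ^ l n) ∧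
      limsup (fun n : ℕ => ((1 / (n : ℝ) * (l n : ℝ) : ℝ) : EReal)) atTop ≤ (r : EReal) := by
  refine ⟨fun n => ⌈Real.logb 2 (2 * (J n : ℝ))⌉₊, fun n => le_two_pow_ceil_logb _, ?_⟩
  have h2 : Tendsto (fun n : ℕ => 2 * (1 / (n : ℝ))) atTop (nhds 0) := by
    simpa using (tendsto_one_div_atTop_nhds_zero_nat (𝕜 := ℝ)).const_mul 2
  rw [← add_zero r]
  refine limsup_le_add h (limsup_le_of_tendsto h2) (Eventually.of_forall fun n => ?_)
  calc 1 / (n : ℝ) * (⌈Real.logb 2 (2 * (J n : ℝ))⌉₊ : ℝ)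
      ≤ 1 / (n : ℝ) * (Real.logb 2 (J n) + 2) := by
        gcongr
        exact ceil_logb_two_mul_le _
    _ = _ := by ring

theorem exists_bits_words (X : Type*) [Fintype X] [Nonempty X] :
    ∃ m : ℕ → ℕ, (∀ n, Fintype.card (Fin n → X) ≤ 2 ^ m n) ∧
      limsup (fun n : ℕ => ((1 / (n : ℝ) * (m n : ℝ) : ℝ) : EReal)) atTop
        ≤ (Real.logb 2 (Fintype.card X) : EReal) := by
  have hX : (1 : ℝ) ≤ Fintype.card X := by exact_mod_cast Fintype.card_pos
  have hl : 0 ≤ Real.logb 2 (Fintype.card X) := Real.logb_nonneg (by norm_num) hX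
  refine ⟨fun n => ⌈Real.logb 2 ((Fintype.card X : ℝ) ^ n)⌉₊, fun n => ?_, ?_⟩
  · have := le_two_pow_ceil_logb ((Fintype.card X : ℝ) ^ n)
    simp only [Fintype.card_fun, Fintype.card_fin]
    exact_mod_cast this
  · have h1 : Tendsto (fun n : ℕ => Real.logb 2 (Fintype.card X) + 1 / (n : ℝ)) atTop
        (nhds (Real.logb 2 (Fintype.card X))) := by
      simpa using (tendsto_one_div_atTop_nhds_zero_nat (𝕜 := ℝ)).const_add
        (Real.logb 2 (Fintype.card X))
    refine le_trans (limsup_le_limsup ?_) (limsup_le_of_tendsto h1)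
    filter_upwards [eventually_ge_atTop 1] with n hn
    have hn' : (0 : ℝ) < n := by exact_mod_cast hn
    rw [EReal.coe_le_coe_iff, Real.logb_pow]
    have hc := (Nat.ceil_lt_add_one (mul_nonneg hn'.le hl)).le
    calc 1 / (n : ℝ) * (⌈(n : ℝ) * Real.logb 2 (Fintype.card X)⌉₊ : ℝ)
        ≤ 1 / (n : ℝ) * (n * Real.logb 2 (Fintype.card X) + 1) := by gcongr
      _ = _ := by field_simp

end Bits

/-! ### Asymptotics and conclusion -/

section Main

variable {X Y : Type*}

/-- Appended blocks have length depending only on `n`, so equal lengths stay equal; this lets one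
construction serve both modes. -/
theorem Code.Allowed.of_length {n : ℕ} {Z Z' : Type*} {m : Mode} {c : Code X Y n Z}
    {c' : Code X Y n Z'} (h : c.Allowed m)
    (h₁ : ∀ x x', (c.enc₁ x).length = (c.enc₁ x').length →
      (c'.enc₁ x).length = (c'.enc₁ x').length)
    (h₂ : ∀ y y', (c.enc₂ y).length = (c.enc₂ y').length →
      (c'.enc₂ y).length = (c'.enc₂ y').length) : c'.Allowed m := by
  cases m with
  | fixedLength => exact ⟨fun x x' => h₁ x x' (h.1 x x'), fun y y' => h₂ y y' (h.2 y y')⟩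
  | variableLength => trivial

variable [Fintype X] [Fintype Y]

theorem swRateLeft_le {P : Source X Y} {m : Mode} {R : ℝ}
    (h : (R, Real.logb 2 (Fintype.card Y)) ∈ swRegion m P) : swRateLeft m P ≤ R := by
  refine csInf_le ⟨0, ?_⟩ h
  rintro R' ⟨c, -, -, hR, -⟩
  exact nonneg_of_limsup_le
    (fun n => mul_nonneg (by positivity) (avgLength₁_nonneg P (c n))) hR

theorem swRateRight_le {P : Source X Y} {m : Mode} {R : ℝ}
    (h : (Real.logb 2 (Fintype.card X), R) ∈ swRegion m P) : swRateRight m P ≤ R := by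
  refine csInf_le ⟨0, ?_⟩ h
  rintro R' ⟨c, -, -, -, hR⟩
  exact nonneg_of_limsup_le
    (fun n => mul_nonneg (by positivity) (avgLength₂_nonneg P (c n))) hR

/-- Robust sets of asymptotically full probability, with subexponential conditional lists. -/
theorem exists_robustSet_seq [DecidableEq X] [DecidableEq Y] {Z : ℕ → Type*} {P : Source X Y}
    (hP : P.Smooth) {f : (n : ℕ) → (Fin n → X) → (Fin n → Y) → Z n}
    (hl : ∀ n, SensitiveGivenLeft (f n)) (hr : ∀ n, SensitiveGivenRight (f n))
    {c : (n : ℕ) → Code X Y n (Z n)}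
    (herr : Tendsto (fun n => (c n).errorProb P (f n)) atTop (nhds 0)) :
    ∃ (G : (n : ℕ) → Set ((Fin n → X) × (Fin n → Y))) (L : ℕ → ℝ) (k : ℕ → ℕ),
      Tendsto (fun n => mass (P.weight n) (G n)ᶜ) atTop (nhds 0) ∧
      (∀ n, ∀ ω ∈ G n, f n ω.1 ω.2 = (c n).dec ((c n).enc₁ ω.1) ((c n).enc₂ ω.2)) ∧
      (∀ n, 1 ≤ L n) ∧ (∀ n : ℕ, ((n : ℝ) + 1) * L n ≤ 2 ^ k n) ∧
      Tendsto (fun n : ℕ => 1 / (n : ℝ) * (k n : ℝ)) atTop (nhds 0) ∧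
      (∀ n s y, ({x | (x, y) ∈ G n ∧ (c n).enc₁ x = s}.ncard : ℝ) ≤ L n) ∧
      (∀ n x t, ({y | (x, y) ∈ G n ∧ (c n).enc₂ y = t}.ncard : ℝ) ≤ L n) := by
  obtain ⟨⟨q₁, hq₁, hq₁', hsm₁⟩, ⟨q₂, hq₂, hq₂', hsm₂⟩⟩ := hP
  set ε : ℕ → ℝ := fun n => (c n).errorProb P (f n) with hε
  have hε0 : ∀ n, 0 ≤ ε n := fun n => by
    simp only [hε, Code.errorProb_eq_mass]
    exact mass_nonneg (P.weight_nonneg n) _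
  have hε1 : ∀ n, ε n ≤ 1 := fun n => by
    simp only [hε, Code.errorProb_eq_mass]
    rw [← P.sum_weight n]
    refine (mass_mono (P.weight_nonneg n) (Set.subset_univ _)).trans (le_of_eq ?_)
    simp [mass]
  have hsqrt : Tendsto (fun n => √(ε n)) atTop (nhds 0) := by
    simpa [Function.comp_def] using (Real.continuous_sqrt.tendsto 0).comp herr
  -- The square root makes both `β` and `ε / β` tend to zero, the term `1 / (n + 1)` keeps `β`
  -- positive when the error is zero, and halving keeps `β ≤ 1`.
  set β : ℕ → ℝ := fun n => (√(ε n) + 1 / ((n : ℝ) + 1)) / 2 with hβdef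
  have hβ : ∀ n, 0 < β n := fun n => by positivity
  have hβ1 : ∀ n, β n ≤ 1 := fun n => by
    have h1 : √(ε n) ≤ 1 := Real.sqrt_le_one.2 (hε1 n)
    have h2 : 1 / ((n : ℝ) + 1) ≤ 1 := by
      rw [div_le_one (by positivity)]
      simp
    simp only [hβdef]
    linarith
  have hβ0 : Tendsto β atTop (nhds 0) := by
    simpa [hβdef] using (hsqrt.add (tendsto_one_div_add_atTop_nhds_zero_nat (𝕜 := ℝ))).div_const 2
  have hεβ : ∀ n, ε n / β n ≤ 2 * √(ε n) := fun n => by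
    rw [div_le_iff₀ (hβ n)]
    have h1 : √(ε n) / 2 ≤ β n := by
      simp only [hβdef]
      gcongr
      simp only [le_add_iff_nonneg_right]
      positivity
    calc ε n = 2 * √(ε n) * (√(ε n) / 2) := by
          rw [mul_assoc, mul_div_assoc', mul_div_assoc', Real.mul_self_sqrt (hε0 n)]
          ring
      _ ≤ 2 * √(ε n) * β n := by gcongr
  choose G hGm hGc hGx hGy using fun n => exists_robustSet P hq₁ hq₁' hq₂ hq₂' (hsm₁ n) (hsm₂ n)
    (hl n) (hr n) (c n) (hβ n)
  set A : ℝ := Fintype.card X + Fintype.card Y with hAdef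
  have hA : 0 ≤ A := by positivity
  obtain ⟨k, hk, hk0⟩ := exists_subexponential_bits hA hβ hβ1 hβ0
  refine ⟨G, fun n => ballBound A (β n) n, k, ?_, hGc,
    fun n => one_le_ballBound hA (hβ n) (hβ1 n) n, hk, hk0, fun n s y => ?_, fun n x t => ?_⟩
  · have hlim : Tendsto (fun n => ε n + (Fintype.card X / q₁ * (2 * √(ε n))
        + Fintype.card Y / q₂ * (2 * √(ε n)))) atTop (nhds 0) := by
      simpa using herr.add (((hsqrt.const_mul 2).const_mul (Fintype.card X / q₁)).add
        ((hsqrt.const_mul 2).const_mul (Fintype.card Y / q₂)))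
    refine squeeze_zero (fun n => mass_nonneg (P.weight_nonneg n) _) (fun n => ?_) hlim
    refine (hGm n).trans ?_
    have hcomm : ∀ t : ℝ, t / β n * ε n = t * (ε n / β n) := fun t => by ring
    rw [hcomm, hcomm]
    gcongr
    · exact hεβ n
    · exact hεβ n
  · refine ncard_le_ballBound (by simp [hAdef]) (hβ n) (hβ1 n) _ fun x hx x' hx' => ?_
    exact hGx n x x' y hx.1 hx'.1 (hx.2.trans hx'.2.symm)
  · refine ncard_le_ballBound (by simp [hAdef]) (hβ n) (hβ1 n) _ fun y hy y' hy' => ?_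
    exact hGy n x y y' hy.1 hy'.1 (hy.2.trans hy'.2.symm)

end Main

end DistComp

open DistComp in
theorem mainTheorem7 {X Y : Type*} [Fintype X] [Fintype Y] [DecidableEq X] [DecidableEq Y]
    {Z : ℕ → Type*} (P : DistComp.Source X Y)
    (f : (n : ℕ) → (Fin n → X) → (Fin n → Y) → Z n) (r : ℝ) (hr : 0 ≤ r)
    (hP : P.Smooth) (hf : DistComp.RTotallySensitive r f) (m : DistComp.Mode) :
    DistComp.rateRegion m P f ⊆
      {R : ℝ × ℝ |
        (∃ l : ℝ, 0 ≤ l ∧ l ≤ 1 ∧ (R.1 + l * r, R.2 + (1 - l) * r) ∈ DistComp.swRegion m P) ∧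
        DistComp.swRateLeft m P ≤ R.1 ∧ DistComp.swRateRight m P ≤ R.2} := by
  rintro ⟨R₁, R₂⟩ ⟨c, hc, herr, hR₁, hR₂⟩
  simp only at hR₁ hR₂
  obtain ⟨hJ, hsl, hsr⟩ := hf
  obtain ⟨l, hl, hlr⟩ := exists_bits_limsup_le hJ
  obtain ⟨G, L, k, hG0, hGc, hL, hk, hk0, hX, hY⟩ := exists_robustSet_seq hP hsl hsr herr
  -- A distribution on words of length 1 forces both alphabets to be nonempty.
  obtain ⟨ω, -⟩ := (P 1).support_nonempty
  have : Nonempty X := ⟨ω.1 0⟩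
  have : Nonempty Y := ⟨ω.2 0⟩
  obtain ⟨mX, hmX, hmX'⟩ := exists_bits_words X
  obtain ⟨mY, hmY, hmY'⟩ := exists_bits_words Y
  have hk0' := limsup_le_of_tendsto hk0
  have herr' : ∀ (C : ℝ) (c' : (n : ℕ) → Code X Y n ((Fin n → X) × (Fin n → Y))),
      (∀ n, (c' n).errorProb P (fun x y => (x, y)) ≤ mass (P.weight n) (G n)ᶜ + C / (n + 1)) →
      Tendsto (fun n => (c' n).errorProb P (fun x y => (x, y))) atTop (nhds 0) := by
    intro C c' h
    have hlim : Tendsto (fun n : ℕ => mass (P.weight n) (G n)ᶜ + C * (1 / ((n : ℝ) + 1))) atTop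
        (nhds 0) := by
      simpa using hG0.add ((tendsto_one_div_add_atTop_nhds_zero_nat (𝕜 := ℝ)).const_mul C)
    refine squeeze_zero (fun n => ?_) (fun n => (h n).trans (le_of_eq (by ring))) hlim
    rw [Code.errorProb_eq_mass]
    exact mass_nonneg (P.weight_nonneg n) _
  -- `λ = 1`: all bits paying for `maxEQ` are appended to the codeword of `x`.
  refine ⟨⟨1, zero_le_one, le_rfl, ?_⟩, swRateLeft_le ?_, swRateRight_le ?_⟩
  · choose c' h₁ h₂ he₁ he₂ he using fun n =>
      exists_code_both P (hL n) (hk n) (hl n) (hGc n) (hX n) (hY n)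
    refine ⟨c', fun n => (hc n).of_length (fun x x' h => by simp [he₁, h])
      (fun y y' h => by simp [he₂, h]), herr' 2 c' he, ?_, ?_⟩
    · have hlk := limsup_le_add hlr hk0' (w := fun n : ℕ => 1 / (n : ℝ) * ((l n + k n : ℕ) : ℝ))
        (Eventually.of_forall fun n => by push_cast; rw [mul_add])
      refine (limsup_le_add hR₁ hlk (Eventually.of_forall fun n => ?_)).trans (by simp)
      rw [avgLength₁_append P (he₁ n), mul_add]
    · refine (limsup_le_add hR₂ hk0' (Eventually.of_forall fun n => ?_)).trans (by simp)
      rw [avgLength₂_append P (he₂ n), mul_add]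
  · choose c' h₁ h₂ he₁ he₂ he using fun n : ℕ => exists_code_left P (hk n) (hmY n) (hX n)
    refine ⟨c', fun n => (hc n).of_length (fun x x' h => by simp [he₁, h])
      (fun y y' h => by simp [he₂]), herr' 1 c' he, ?_, ?_⟩
    · refine (limsup_le_add hR₁ hk0' (Eventually.of_forall fun n => ?_)).trans (by simp)
      rw [avgLength₁_append P (he₁ n), mul_add]
    · simpa only [avgLength₂_ofFn P (he₂ _)] using hmY'
  · choose c' h₁ h₂ he₁ he₂ he using fun n : ℕ => exists_code_right P (hk n) (hmX n) (hY n)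
    refine ⟨c', fun n => (hc n).of_length (fun x x' h => by simp [he₁])
      (fun y y' h => by simp [he₂, h]), herr' 1 c' he, ?_, ?_⟩
    · simpa only [avgLength₁_ofFn P (he₁ _)] using hmX'
    · refine (limsup_le_add hR₂ hk0' (Eventually.of_forall fun n => ?_)).trans (by simp)
      rw [avgLength₂_append P (he₂ n), mul_add]
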